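/- Let $\varphi:\mathbb R\to\mathbb C$ be continuous on $\mathbb R$ and $C^1$ on $\mathbb R\setminus\{0\}$, with $\varphi(0)=1$ and $\operatorname{supp}\varphi\subset[-1,1]$. Suppose that for some $\varepsilon>0$ the functions $\varphi(x)$ (on $\mathbb R$) and $x\varphi'(x)$ (on $\mathbb R\setminus\{0\}$) both have finite total variation and both satisfy a Lipschitz (Hölder) condition of order $\varepsilon$, i.e. $|g(x)-g(y)|\le C|x-y|^{\varepsilon}$ for all $x,y$ in the domain, with some constant $C$. Let $f\in L_1(\mathbb T)$ be complex-valued and $2\pi$-periodic, $\mathbb T=\mathbb R/2\pi\mathbb Z$, with Fourier coefficients $\widehat f_k=\frac1{2\pi}\int_{-\pi}^{\pi}f(t)e^{-ikt}\,dt$. Then at every $d$-point $x$ of $f$, that is, at every $x$ for which the (two-sided) limit $$d_f(x)=\lim_{h\to0}\frac1h\int_0^h f(x+t)\,dt$$ exists and is finite, $$\lim_{n\to\infty}\ \sum_{|k|\le n}\varphi\Big(\frac{k}{n+1}\Big)\widehat f_k\,e^{ikx}=d_f(x).$$ -/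

import Mathlib

open MeasureTheory Filter Topology
open scoped NNReal Real

instance instFactTwoPiPos : Fact (0 < 2 * π) := ⟨Real.two_pi_pos⟩

/-- `x` is a `d`-point of the function `f` on the circle `ℝ / 2πℤ`, with value `d = d_f(x)`:
the means `(1/h) ∫₀ʰ f(x+t) dt` converge to `d` as `h → 0`, `h ≠ 0` (from both sides). For
integrable `f` this says that the indefinite integral of `f` has derivative `d` at `x`. -/
def HasDValueAt (f : AddCircle (2 * π) → ℂ) (x : AddCircle (2 * π)) (d : ℂ) : Prop :=
  Tendsto (fun h : ℝ => (1 / (h : ℂ)) * ∫ t in (0 : ℝ)..h, f (x + (t : AddCircle (2 * π))))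
    (𝓝[≠] 0) (𝓝 d)

/-- The class `V ∩ Lip ε` on a set `s` of reals: finite total variation on `s`, and a Lipschitz
condition of order `ε`, `|g(x) - g(y)| ≤ C |x - y| ^ ε` for `x, y ∈ s`. -/
def BVLipOn (ε : ℝ≥0) (g : ℝ → ℂ) (s : Set ℝ) : Prop :=
  BoundedVariationOn g s ∧ ∃ C : ℝ≥0, HolderOnWith C ε g s

/-- The means `∑_{|k| ≤ n} φ(k/(n+1)) f̂ₖ e^{ikx}` of the Fourier series of `f`. -/
noncomputable def phiMean (φ : ℝ → ℂ) (f : AddCircle (2 * π) → ℂ) (n : ℕ)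
    (x : AddCircle (2 * π)) : ℂ :=
  ∑ k ∈ Finset.Icc (-(n : ℤ)) (n : ℤ),
    φ ((k : ℝ) / ((n : ℝ) + 1)) * fourierCoeff f k * fourier k x

open scoped FourierTransform ENNReal ContDiff

/-! Put `P y = y * φ y` and `ψ y = y * φ' y`, so that `P' = φ + ψ`. By the Bernstein–Zygmund
criterion `BVLipOn.integrable_fourier`, both `𝓕 φ` and `𝓕 ψ` are integrable, hence so is `𝓕 P' v =
2πi v 𝓕 P v`; by inversion at `0` its integral is `P' 0 = φ 0 = 1`.

Let `F` be the indefinite integral of `f` started at `x`. By `phiMean_eq_integral` the mean is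
`i(n+1) ∫ 𝓕 P v * F (2πv/(n+1)) dv`, which is the integral of the kernel `2πi v 𝓕 P v` against `F h
/ h` with `h = 2πv/(n+1)`. At a `d`-point `F h / h` tends to `d` and is bounded over all `h`, so
dominated convergence gives `d`. Using `P` in place of `φ` is a built-in integration by parts: only
the averages `F h / h` are controlled at a `d`-point, not `f` itself. -/

/-! ### Plancherel for functions in `L¹ ∩ L²` -/

theorem Real.continuous_fourier_of_integrable {f : ℝ → ℂ} (hf : Integrable f) :
    Continuous (𝓕 f) :=
  VectorFourier.fourierIntegral_continuous Real.continuous_fourierChar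
    (by exact continuous_inner) hf

/-- The two transforms agree as tempered distributions: tested against a smooth compactly supported
`g`, each moves the transform onto `g`. -/
theorem MeasureTheory.MemLp.fourier_toLp_ae_eq {f : ℝ → ℂ} (hf : Integrable f)
    (hf2 : MemLp f 2) : (𝓕 (hf2.toLp f) : Lp ℂ 2 (volume : Measure ℝ)) =ᵐ[volume] 𝓕 f := by
  refine ae_eq_of_integral_contDiff_smul_eq
    ((Lp.memLp _).locallyIntegrable (by norm_num))
    (Real.continuous_fourier_of_integrable hf).locallyIntegrable fun g hg hgc => ?_
  have hgc' : HasCompactSupport fun x => (g x : ℂ) :=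
    hgc.comp_left (g := ((↑) : ℝ → ℂ)) Complex.ofReal_zero
  have hg' : ContDiff ℝ ∞ fun x => (g x : ℂ) := Complex.ofRealCLM.contDiff.comp hg
  let G : SchwartzMap ℝ ℂ := hgc'.toSchwartzMap hg'
  have h1 := congrArg (fun T => T G) (Lp.fourier_toTemperedDistribution_eq (hf2.toLp f))
  simp only [TemperedDistribution.fourier_apply, Lp.toTemperedDistribution_apply] at h1
  have hG : ∀ x, G x = (g x : ℂ) := fun x => rfl
  simp only [hG, SchwartzMap.fourier_coe] at h1
  have h2 : ∫ x, 𝓕 (G : ℝ → ℂ) x • (hf2.toLp f) x = ∫ x, 𝓕 (G : ℝ → ℂ) x • f x := by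
    refine integral_congr_ae ?_
    filter_upwards [hf2.coeFn_toLp] with x hx
    rw [hx]
  have h3 : ∫ x, 𝓕 (G : ℝ → ℂ) x • f x = ∫ x, G x • 𝓕 f x :=
    VectorFourier.integral_fourierIntegral_smul_eq_flip (L := innerₗ ℝ)
      Real.continuous_fourierChar continuous_inner G.integrable hf |>.trans (by
        simp only [flip_innerₗ]; rfl)
  rw [h2, h3] at h1
  simp only [hG, smul_eq_mul] at h1
  simpa only [Complex.real_smul] using h1.symm

/-- **Plancherel's theorem** for integrable square-integrable functions. -/
theorem MeasureTheory.MemLp.eLpNorm_fourier_eq {f : ℝ → ℂ} (hf : Integrable f)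
    (hf2 : MemLp f 2) : eLpNorm (𝓕 f) 2 = eLpNorm f 2 := by
  rw [← eLpNorm_congr_ae (MemLp.fourier_toLp_ae_eq hf hf2),
    ← eLpNorm_congr_ae hf2.coeFn_toLp, ← Lp.enorm_def, ← Lp.enorm_def,
    ← ofReal_norm, ← ofReal_norm, Lp.norm_fourier_eq]

theorem MeasureTheory.MemLp.lintegral_fourier_sq_eq {f : ℝ → ℂ} (hf : Integrable f)
    (hf2 : MemLp f 2) : ∫⁻ u, ‖𝓕 f u‖ₑ ^ 2 = ∫⁻ x, ‖f x‖ₑ ^ 2 := by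
  have h := MemLp.eLpNorm_fourier_eq hf hf2
  have key := fun g : ℝ → ℂ => eLpNorm_nnreal_pow_eq_lintegral (μ := volume) (f := g)
    (p := 2) two_ne_zero
  have h1 := key (𝓕 f)
  have h2 := key f
  simp only [NNReal.coe_ofNat, ENNReal.coe_ofNat, ENNReal.rpow_ofNat] at h1 h2
  rw [← h1, ← h2, h]

theorem Real.fourier_comp_add_right (f : ℝ → ℂ) (h u : ℝ) :
    𝓕 (fun x => f (x + h)) u = (𝐞 (h * u) : ℂ) * 𝓕 f u := by
  have := congrFun (VectorFourier.fourierIntegral_comp_add_right Real.fourierChar volume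
    (innerₗ ℝ) f h) u
  rw [innerₗ_apply_apply, RCLike.inner_apply, conj_trivial, mul_comm u h, Circle.smul_def,
    smul_eq_mul] at this
  exact this

/-! ### Bounded variation, Hölder continuity and integrable Fourier transforms -/

theorem BoundedVariationOn.dist_le_toReal_sub {g : ℝ → ℂ} {s : Set ℝ}
    (hg : BoundedVariationOn g s) {x y : ℝ} (hx : x ∈ s) (hy : y ∈ s) (hxy : x ≤ y) :
    dist (g x) (g y) ≤
      (eVariationOn g (s ∩ Set.Iic y)).toReal - (eVariationOn g (s ∩ Set.Iic x)).toReal := by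
  have h1 := eVariationOn.add_le_union g (s := s ∩ Set.Iic x) (t := {x, y})
    (by rintro a ⟨-, ha⟩ b (rfl | rfl); exacts [ha, le_trans ha hxy])
  rw [eVariationOn.pair] at h1
  have h2 : eVariationOn g (s ∩ Set.Iic x ∪ {x, y}) ≤ eVariationOn g (s ∩ Set.Iic y) := by
    refine eVariationOn.mono _ ?_
    rintro a (⟨ha, hax⟩ | rfl | rfl)
    exacts [⟨ha, le_trans hax hxy⟩, ⟨hx, hxy⟩, ⟨hy, Set.mem_Iic.2 le_rfl⟩]
  have hfin : ∀ z, eVariationOn g (s ∩ Set.Iic z) ≠ ⊤ := fun z =>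
    hg.mono Set.inter_subset_left
  have h3 := ENNReal.toReal_mono (hfin y) (h1.trans h2)
  rw [ENNReal.toReal_add (hfin x) (edist_ne_top _ _), ← dist_edist] at h3
  linarith

/-- The increment is at most `V (x + h) - V x` for the monotone variation function `V`; the integral
of that difference reduces to two windows of length `h`, where `0 ≤ V ≤` the total variation. -/
theorem BoundedVariationOn.integral_norm_sub_le {g : ℝ → ℂ} {s : Set ℝ}
    (hg : BoundedVariationOn g s) (hs : ∀ᵐ x, x ∈ s) (hc : Continuous g) {a b h : ℝ}
    (hab : a ≤ b) (hh : 0 ≤ h) :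
    ∫ x in a..b, ‖g (x + h) - g x‖ ≤ h * (eVariationOn g s).toReal := by
  set V : ℝ → ℝ := fun x => (eVariationOn g (s ∩ Set.Iic x)).toReal with hV
  have hfin : ∀ z, eVariationOn g (s ∩ Set.Iic z) ≠ ⊤ := fun z =>
    hg.mono Set.inter_subset_left
  have hmono : Monotone V := fun x y hxy => ENNReal.toReal_mono (hfin y)
    (eVariationOn.mono _ (Set.inter_subset_inter_right _ (Set.Iic_subset_Iic.2 hxy)))
  have hle : ∀ x, V x ≤ (eVariationOn g s).toReal := fun x =>
    ENNReal.toReal_mono hg (eVariationOn.mono _ Set.inter_subset_left)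
  have h0 : ∀ x, 0 ≤ V x := fun x => ENNReal.toReal_nonneg
  have hi : ∀ c d, IntervalIntegrable V volume c d := fun c d => hmono.intervalIntegrable
  have hmono' : Monotone fun x => V (x + h) := fun x y hxy => hmono (by linarith)
  have hs' : ∀ᵐ x, x + h ∈ s :=
    (measurePreserving_add_right volume h).quasiMeasurePreserving.ae hs
  calc ∫ x in a..b, ‖g (x + h) - g x‖
      ≤ ∫ x in a..b, (V (x + h) - V x) := by
        refine intervalIntegral.integral_mono_ae hab ?_
          (hmono'.intervalIntegrable.sub (hi _ _)) ?_
        · exact Continuous.intervalIntegrable (by fun_prop) _ _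
        · filter_upwards [hs, hs'] with x hx hx'
          rw [← dist_eq_norm, dist_comm]
          exact hg.dist_le_toReal_sub hx hx' (by linarith)
    _ = (∫ x in b..(b + h), V x) - ∫ x in a..(a + h), V x := by
        rw [intervalIntegral.integral_sub hmono'.intervalIntegrable (hi _ _),
          intervalIntegral.integral_comp_add_right (fun x => V x),
          intervalIntegral.integral_interval_sub_interval_comm (hi _ _) (hi _ _) (hi _ _),
          intervalIntegral.integral_symm a (a + h), intervalIntegral.integral_symm b (b + h)]
        ring
    _ ≤ (∫ x in b..(b + h), (eVariationOn g s).toReal) - 0 := by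
        refine sub_le_sub (intervalIntegral.integral_mono_on (by linarith) (hi _ _)
          intervalIntegrable_const fun x _ => hle x) ?_
        exact intervalIntegral.integral_nonneg (by linarith) fun x _ => h0 x
    _ = h * (eVariationOn g s).toReal := by simp

/-- One factor of the square is bounded by the Hölder condition, giving `h ^ ε`; the other is
integrated by means of the variation, giving `h`. -/
theorem BVLipOn.lintegral_norm_sub_sq_le {ε : ℝ≥0} {g : ℝ → ℂ} {s : Set ℝ}
    (hg : BVLipOn ε g s) (hs : ∀ᵐ x, x ∈ s) (hc : Continuous g)
    (hsupp : ∀ x, 1 < |x| → g x = 0) :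
    ∃ C : ℝ, 0 ≤ C ∧ ∀ h : ℝ, 0 < h → h ≤ 1 →
      ∫⁻ x, ‖g (x + h) - g x‖ₑ ^ 2 ≤ ENNReal.ofReal (C * h ^ (1 + (ε : ℝ))) := by
  obtain ⟨hbv, C, hC⟩ := hg
  refine ⟨C * (eVariationOn g s).toReal, by positivity, fun h hh hh1 => ?_⟩
  have hs' : ∀ᵐ x, x + h ∈ s :=
    (measurePreserving_add_right volume h).quasiMeasurePreserving.ae hs
  have hcont : Continuous fun x => ‖g (x + h) - g x‖ := by fun_prop
  have hpt : ∀ᵐ x, ‖g (x + h) - g x‖ₑ ^ 2 ≤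
      (Set.Ioc (-3 : ℝ) 3).indicator
        (fun x => ENNReal.ofReal (C * h ^ (ε : ℝ) * ‖g (x + h) - g x‖)) x := by
    filter_upwards [hs, hs'] with x hx hx'
    by_cases hm : x ∈ Set.Ioc (-3 : ℝ) 3
    · rw [Set.indicator_of_mem hm, ← ofReal_norm, ← ENNReal.ofReal_pow (norm_nonneg _), sq]
      refine ENNReal.ofReal_le_ofReal (mul_le_mul_of_nonneg_right ?_ (norm_nonneg _))
      have := hC.dist_le hx' hx
      rwa [dist_eq_norm, Real.dist_eq, add_sub_cancel_left, abs_of_pos hh] at this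
    · have h1 : 1 < |x| ∧ 1 < |x + h| := by
        rw [Set.mem_Ioc, not_and_or, not_lt, not_le] at hm
        rcases hm with hm | hm
        · exact ⟨lt_abs.2 (Or.inr (by linarith)), lt_abs.2 (Or.inr (by linarith))⟩
        · exact ⟨lt_abs.2 (Or.inl (by linarith)), lt_abs.2 (Or.inl (by linarith))⟩
      simp [hsupp _ h1.1, hsupp _ h1.2]
  refine (lintegral_mono_ae hpt).trans ?_
  rw [lintegral_indicator measurableSet_Ioc, ← ofReal_integral_eq_lintegral_ofReal
    ((hcont.const_mul _).integrableOn_Icc.mono_set Set.Ioc_subset_Icc_self)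
    (Eventually.of_forall fun x => by positivity), integral_const_mul]
  refine ENNReal.ofReal_le_ofReal ?_
  rw [← intervalIntegral.integral_of_le (by norm_num)]
  calc C * h ^ (ε : ℝ) * ∫ x in (-3 : ℝ)..3, ‖g (x + h) - g x‖
      ≤ C * h ^ (ε : ℝ) * (h * (eVariationOn g s).toReal) :=
        mul_le_mul_of_nonneg_left (hbv.integral_norm_sub_le hs hc (by norm_num) hh.le)
          (by positivity)
    _ = C * (eVariationOn g s).toReal * h ^ (1 + (ε : ℝ)) := by
        rw [Real.rpow_add hh, Real.rpow_one]; ring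

/-- The angle `2π|θ|` lies in `[π/2, π]`, so the cosine is nonpositive. -/
theorem one_le_norm_fourierChar_sub_one {θ : ℝ} (h1 : 1 / 4 ≤ |θ|) (h2 : |θ| ≤ 1 / 2) :
    1 ≤ ‖(𝐞 θ : ℂ) - 1‖ := by
  have hcos : Real.cos (2 * π * θ) ≤ 0 := by
    rw [← Real.cos_abs, abs_mul, abs_of_pos Real.two_pi_pos]
    apply Real.cos_nonpos_of_pi_div_two_le_of_le <;> nlinarith [Real.pi_pos]
  calc (1 : ℝ) ≤ |((𝐞 θ : ℂ) - 1).re| := by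
        rw [Real.fourierChar_apply, Complex.sub_re, Complex.exp_ofReal_mul_I_re, Complex.one_re,
          abs_of_nonpos (by linarith)]
        linarith
    _ ≤ _ := Complex.abs_re_le_norm _

/-- **Bernstein–Zygmund criterion**: a compactly supported function of bounded variation which is
Hölder continuous of some positive order has an integrable Fourier transform. -/
theorem BVLipOn.integrable_fourier {ε : ℝ≥0} (hε : 0 < ε) {g : ℝ → ℂ} {s : Set ℝ}
    (hg : BVLipOn ε g s) (hs : ∀ᵐ x, x ∈ s) (hc : Continuous g)
    (hsupp : ∀ x, 1 < |x| → g x = 0) : Integrable (𝓕 g) := by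
  obtain ⟨C, hC0, hC⟩ := hg.lintegral_norm_sub_sq_le hs hc hsupp
  have hε' : (0 : ℝ) < ε := hε
  have hcs : HasCompactSupport g :=
    HasCompactSupport.of_support_subset_isCompact (isCompact_Icc (a := -1) (b := 1))
      fun x hx => abs_le.1 <| not_lt.1 fun h => hx (hsupp x h)
  have hgi : Integrable g := hc.integrable_of_hasCompactSupport hcs
  have hg2 : MemLp g 2 := hc.memLp_of_hasCompactSupport hcs
  have hFc : Continuous (𝓕 g) := Real.continuous_fourier_of_integrable hgi
  -- Any exponent strictly between `1` and `1 + ε` would do: above `1` for `(1 + |u|) ^ (-r)` to be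
  -- integrable, below `1 + ε` for the dyadic sum to converge.
  set r : ℝ := 1 + ε / 2 with hr
  have hr0 : 0 < r := by positivity
  -- For `2 ^ k ≤ |u| < 2 ^ (k + 1)` this shift puts `|H k * u|` in `[1/4, 1/2)`, where the
  -- multiplier `𝐞 (H k * u) - 1` has norm at least `1`.
  set H : ℕ → ℝ := fun k => 2 ^ (-((k : ℝ) + 2)) with hH
  have hHpos : ∀ k, 0 < H k := fun k => by positivity
  have hHle : ∀ k, H k ≤ 1 := fun k =>
    Real.rpow_le_one_of_one_le_of_nonpos (by norm_num) (by have := k.cast_nonneg (α := ℝ); linarith)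
  -- Plancherel for the differences
  have hdiff : ∀ k, ∫⁻ u, ‖(𝐞 (H k * u) : ℂ) - 1‖ₑ ^ 2 * ‖𝓕 g u‖ₑ ^ 2 ≤
      ENNReal.ofReal (C * H k ^ (1 + (ε : ℝ))) := fun k => by
    have hi : Integrable fun x => g (x + H k) := hgi.comp_add_right _
    have h2 : MemLp (fun x => g (x + H k)) 2 :=
      hg2.comp_measurePreserving (measurePreserving_add_right volume (H k))
    have hF : ∀ u, 𝓕 (fun x => g (x + H k) - g x) u = ((𝐞 (H k * u) : ℂ) - 1) * 𝓕 g u :=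
      fun u => by
        rw [sub_mul, one_mul, ← Real.fourier_comp_add_right]
        simp only [Real.fourier_eq, smul_sub]
        exact integral_sub ((Real.fourierIntegral_convergent_iff u).2 hi)
          ((Real.fourierIntegral_convergent_iff u).2 hgi)
    have hP := MemLp.lintegral_fourier_sq_eq (hi.sub hgi) (h2.sub hg2)
    refine le_trans (le_of_eq ?_) (hC (H k) (hHpos k) (hHle k))
    refine Eq.trans ?_ hP
    refine lintegral_congr fun u => ?_
    rw [← mul_pow, ← enorm_mul, ← hF]
    rfl
  -- pointwise dyadic bound
  have hdy : ∀ u : ℝ, ENNReal.ofReal ((1 + |u|) ^ r) * ‖𝓕 g u‖ₑ ^ 2 ≤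
      ENNReal.ofReal (2 ^ r) * ‖𝓕 g u‖ₑ ^ 2 + ∑' k, ENNReal.ofReal ((H k) ^ (-r)) *
        (‖(𝐞 (H k * u) : ℂ) - 1‖ₑ ^ 2 * ‖𝓕 g u‖ₑ ^ 2) := fun u => by
    rcases le_total |u| 1 with hu | hu
    · refine le_add_right ?_
      gcongr
      linarith
    · obtain ⟨k, hk1, hk2⟩ := exists_nat_pow_near hu (one_lt_two)
      have hHk : H k = (2 ^ (k + 2))⁻¹ := by
        simp only [hH]
        rw [Real.rpow_neg zero_le_two, ← Real.rpow_natCast]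
        push_cast; rfl
      refine le_trans ?_ (le_add_left (ENNReal.le_tsum k))
      have h1 : (1 : ℝ≥0∞) ≤ ‖(𝐞 (H k * u) : ℂ) - 1‖ₑ := by
        rw [← ofReal_norm, ENNReal.one_le_ofReal]
        have hp : (0 : ℝ) < 2 ^ k := by positivity
        apply one_le_norm_fourierChar_sub_one <;>
          rw [abs_mul, abs_of_pos (hHpos k), hHk, inv_mul_eq_div]
        · rw [le_div_iff₀ (by positivity), pow_add]; linarith
        · rw [div_le_iff₀ (by positivity), pow_add]; rw [pow_succ] at hk2; linarith
      refine mul_le_mul' (ENNReal.ofReal_le_ofReal ?_)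
        (le_mul_of_one_le_left' (one_le_pow₀ h1))
      rw [Real.rpow_neg (hHpos k).le, ← Real.inv_rpow (hHpos k).le]
      refine Real.rpow_le_rpow (by positivity) ?_ hr0.le
      rw [hHk, inv_inv, pow_add]
      rw [pow_succ] at hk2
      linarith
  have hweight : ∫⁻ u : ℝ, ENNReal.ofReal ((1 + |u|) ^ r) * ‖𝓕 g u‖ₑ ^ 2 < ⊤ := by
    have hmeas : Measurable fun u => ‖𝓕 g u‖ₑ ^ 2 := by fun_prop
    have hmeas' : ∀ k, Measurable fun u : ℝ => ‖(𝐞 (H k * u) : ℂ) - 1‖ₑ ^ 2 * ‖𝓕 g u‖ₑ ^ 2 :=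
      fun k => by
        have : Continuous fun u : ℝ => (𝐞 (H k * u) : ℂ) - 1 := by
          have := Real.continuous_fourierChar
          fun_prop
        fun_prop
    refine (lintegral_mono hdy).trans_lt ?_
    rw [lintegral_add_left (hmeas.const_mul _), lintegral_const_mul _ hmeas,
      lintegral_tsum fun k => ((hmeas' k).const_mul _).aemeasurable,
      MemLp.lintegral_fourier_sq_eq hgi hg2]
    refine ENNReal.add_lt_top.2 ⟨ENNReal.mul_lt_top ENNReal.ofReal_lt_top ?_, ?_⟩
    · have := hg2.eLpNorm_lt_top
      have key := eLpNorm_nnreal_pow_eq_lintegral (μ := volume) (f := g)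
        (p := 2) two_ne_zero
      simp only [NNReal.coe_ofNat, ENNReal.coe_ofNat, ENNReal.rpow_ofNat] at key
      rw [← key]
      exact ENNReal.pow_lt_top this
    · have hsum : Summable fun k : ℕ => C * 2 ^ (-(ε : ℝ)) * ((2 : ℝ) ^ (-(ε / 2 : ℝ))) ^ k := by
        refine (summable_geometric_of_lt_one (by positivity) ?_).mul_left _
        exact Real.rpow_lt_one_of_one_lt_of_neg one_lt_two (by linarith)
      refine lt_of_le_of_lt (ENNReal.tsum_le_tsum fun k => ?_) hsum.tsum_ofReal_lt_top
      rw [lintegral_const_mul _ (hmeas' k)]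
      refine (mul_le_mul_right (hdiff k) _).trans (le_of_eq ?_)
      rw [← ENNReal.ofReal_mul (by positivity)]
      congr 1
      have : H k ^ (-r) * (C * H k ^ (1 + (ε : ℝ))) = C * H k ^ (ε / 2 : ℝ) := by
        rw [mul_left_comm, ← Real.rpow_add (hHpos k), hr]
        congr 2; ring
      rw [this, hH]
      simp only
      rw [← Real.rpow_natCast, ← Real.rpow_mul zero_le_two, ← Real.rpow_mul zero_le_two, mul_assoc,
        ← Real.rpow_add zero_lt_two]
      congr 2; ring
  have hint1 : Integrable fun u : ℝ => (1 + |u|) ^ r * ‖𝓕 g u‖ ^ 2 := by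
    refine ⟨?_, ?_⟩
    · refine Continuous.aestronglyMeasurable ?_
      refine Continuous.mul (Continuous.rpow_const (by fun_prop) fun u => Or.inr hr0.le)
        (by fun_prop)
    · rw [hasFiniteIntegral_iff_ofReal (Eventually.of_forall fun u => by positivity)]
      refine lt_of_eq_of_lt (lintegral_congr fun u => ?_) hweight
      rw [ENNReal.ofReal_mul (by positivity), ENNReal.ofReal_pow (norm_nonneg _), ofReal_norm]
  have hint2 : Integrable fun u : ℝ => (1 + ‖u‖) ^ (-r) :=
    integrable_one_add_norm (by simp [hr, hε'])
  refine (hint1.add hint2).mono' hFc.aestronglyMeasurable (Eventually.of_forall fun u => ?_)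
  have hw : (0 : ℝ) < (1 + |u|) ^ r := by positivity
  simp only [Pi.add_apply, Real.norm_eq_abs]
  rw [Real.rpow_neg (by positivity)]
  set w := (1 + |u|) ^ r
  set a := ‖𝓕 g u‖
  -- AM–GM, playing the role of Cauchy–Schwarz with weight `w`.
  have h2 : a * 2 ≤ w * a ^ 2 + w⁻¹ := by
    have : w * a ^ 2 + w⁻¹ - a * 2 = w * (a - w⁻¹) ^ 2 := by field_simp; ring
    nlinarith [mul_nonneg hw.le (sq_nonneg (a - w⁻¹))]
  have : 0 ≤ a := norm_nonneg _
  linarith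

/-! ### The indefinite integral on the circle -/

theorem AddCircle.periodic_translate {E : Type*} (f : AddCircle (2 * π) → E)
    (x : AddCircle (2 * π)) :
    Function.Periodic (fun s : ℝ => f (x + (s : AddCircle (2 * π)))) (2 * π) := fun s => by
  simp only [AddCircle.coe_add_period]

theorem AddCircle.intervalIntegrable_translate {f : AddCircle (2 * π) → ℂ}
    (hf : Integrable f AddCircle.haarAddCircle) (x : AddCircle (2 * π)) (a b : ℝ) :
    IntervalIntegrable (fun s : ℝ => f (x + (s : AddCircle (2 * π)))) volume a b := by
  have hv : Integrable f volume := by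
    rw [AddCircle.volume_eq_smul_haarAddCircle]
    exact hf.smul_measure ENNReal.ofReal_ne_top
  have hx : Integrable (fun y => f (x + y)) volume := hv.comp_add_left x
  refine (AddCircle.periodic_translate f x).intervalIntegrable₀ Real.two_pi_pos.ne' ?_ a b
  rw [intervalIntegrable_iff_integrableOn_Ioc_of_le Real.two_pi_pos.le]
  have := (AddCircle.measurePreserving_mk (2 * π) 0).integrable_comp_of_integrable hx
  rwa [zero_add] at this

theorem AddCircle.integral_norm_translate_period (f : AddCircle (2 * π) → ℂ)
    (x : AddCircle (2 * π)) :
    ∫ s in (0 : ℝ)..2 * π, ‖f (x + (s : AddCircle (2 * π)))‖ =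
      2 * π * ∫ y, ‖f y‖ ∂AddCircle.haarAddCircle := by
  have := AddCircle.intervalIntegral_preimage (2 * π) 0 fun y => ‖f (x + y)‖
  rw [zero_add] at this
  rw [this, integral_add_left_eq_self (μ := volume) (fun y => ‖f y‖) x,
    AddCircle.integral_haarAddCircle, smul_eq_mul, mul_inv_cancel_left₀ Real.two_pi_pos.ne']

/-- Cover `[a, b]` by whole periods; rounding up costs at most one extra period. -/
theorem AddCircle.integral_norm_translate_le {f : AddCircle (2 * π) → ℂ}
    (hf : Integrable f AddCircle.haarAddCircle) (x : AddCircle (2 * π)) {a b : ℝ} (hab : a ≤ b) :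
    ∫ s in a..b, ‖f (x + (s : AddCircle (2 * π)))‖ ≤
      (b - a + 2 * π) * ∫ y, ‖f y‖ ∂AddCircle.haarAddCircle := by
  have hT := Real.two_pi_pos
  have hper := AddCircle.periodic_translate (fun y => ‖f y‖) x
  have hi := fun c d => (AddCircle.intervalIntegrable_translate hf x c d).norm
  set n := ⌈(b - a) / (2 * π)⌉₊ with hn
  have h1 : b - a ≤ n * (2 * π) := (div_le_iff₀ hT).1 (Nat.le_ceil _)
  have h2 : (n : ℝ) < (b - a) / (2 * π) + 1 := Nat.ceil_lt_add_one (by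
    have : 0 ≤ b - a := by linarith
    positivity)
  calc ∫ s in a..b, ‖f (x + (s : AddCircle (2 * π)))‖
      ≤ ∫ s in a..(a + (n : ℤ) • (2 * π)), ‖f (x + (s : AddCircle (2 * π)))‖ := by
        refine intervalIntegral.integral_mono_interval le_rfl hab ?_
          (Eventually.of_forall fun s => norm_nonneg _) (hi _ _)
        simp only [zsmul_eq_mul, Int.cast_natCast]; linarith
    _ = n * (2 * π * ∫ y, ‖f y‖ ∂AddCircle.haarAddCircle) := by
        rw [hper.intervalIntegral_add_zsmul_eq n a hi, hper.intervalIntegral_add_eq a 0, zero_add,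
          AddCircle.integral_norm_translate_period]
        simp
    _ ≤ ((b - a) / (2 * π) + 1) * (2 * π * ∫ y, ‖f y‖ ∂AddCircle.haarAddCircle) :=
        mul_le_mul_of_nonneg_right h2.le
          (mul_nonneg hT.le (integral_nonneg fun _ => norm_nonneg _))
    _ = _ := by field_simp

/-- The indefinite integral of `f` along the circle, started at `x`. -/
noncomputable def circlePrimitive (f : AddCircle (2 * π) → ℂ) (x : AddCircle (2 * π)) (t : ℝ) : ℂ :=
  ∫ s in (0 : ℝ)..t, f (x + (s : AddCircle (2 * π)))

theorem norm_circlePrimitive_le {f : AddCircle (2 * π) → ℂ}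
    (hf : Integrable f AddCircle.haarAddCircle) (x : AddCircle (2 * π)) (t : ℝ) :
    ‖circlePrimitive f x t‖ ≤ (|t| + 2 * π) * ∫ y, ‖f y‖ ∂AddCircle.haarAddCircle := by
  unfold circlePrimitive
  rcases le_total 0 t with ht | ht
  · refine (intervalIntegral.norm_integral_le_integral_norm ht).trans ?_
    simpa [abs_of_nonneg ht] using AddCircle.integral_norm_translate_le hf x ht
  · rw [intervalIntegral.integral_symm, norm_neg]
    refine (intervalIntegral.norm_integral_le_integral_norm ht).trans ?_
    simpa [abs_of_nonpos ht] using AddCircle.integral_norm_translate_le hf x ht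

theorem continuous_circlePrimitive {f : AddCircle (2 * π) → ℂ}
    (hf : Integrable f AddCircle.haarAddCircle) (x : AddCircle (2 * π)) :
    Continuous (circlePrimitive f x) :=
  intervalIntegral.continuous_primitive (AddCircle.intervalIntegrable_translate hf x) 0

theorem circlePrimitive_add {f g : AddCircle (2 * π) → ℂ}
    (hf : Integrable f AddCircle.haarAddCircle) (hg : Integrable g AddCircle.haarAddCircle)
    (x : AddCircle (2 * π)) (t : ℝ) :
    circlePrimitive (f + g) x t = circlePrimitive f x t + circlePrimitive g x t :=
  intervalIntegral.integral_add (AddCircle.intervalIntegrable_translate hf x 0 t)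
    (AddCircle.intervalIntegrable_translate hg x 0 t)

theorem circlePrimitive_smul (c : ℂ) (f : AddCircle (2 * π) → ℂ) (x : AddCircle (2 * π)) (t : ℝ) :
    circlePrimitive (c • f) x t = c * circlePrimitive f x t :=
  intervalIntegral.integral_const_mul c _

theorem fourier_coe_two_pi (k : ℤ) (s : ℝ) :
    fourier k (s : AddCircle (2 * π)) = Complex.exp (k * Complex.I * s) := by
  rw [fourier_coe_apply]
  congr 1
  push_cast
  have : (π : ℂ) ≠ 0 := by exact_mod_cast Real.pi_ne_zero
  field_simp

theorem circlePrimitive_fourier_zero (x : AddCircle (2 * π)) (t : ℝ) :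
    circlePrimitive (fourier 0) x t = t := by
  simp [circlePrimitive]

theorem circlePrimitive_fourier {k : ℤ} (hk : k ≠ 0) (x : AddCircle (2 * π)) (t : ℝ) :
    circlePrimitive (fourier k) x t =
      fourier k x * ((Complex.exp (k * Complex.I * t) - 1) / (k * Complex.I)) := by
  have h0 : (k * Complex.I : ℂ) ≠ 0 := mul_ne_zero (by exact_mod_cast hk) Complex.I_ne_zero
  have : ∀ s : ℝ, fourier k (x + (s : AddCircle (2 * π))) =
      fourier k x * Complex.exp (k * Complex.I * s) := fun s => by
    rw [← fourier_coe_two_pi, fourier_apply, fourier_apply, fourier_apply, smul_add,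
      AddCircle.toCircle_add, Circle.coe_mul]
  simp only [circlePrimitive, this]
  rw [intervalIntegral.integral_const_mul, integral_exp_mul_complex h0]
  simp

/-! ### The mean as an integral of the primitive -/

/-- An additive homogeneous functional on the functions on the circle which is bounded in the
`L¹` norm and vanishes on the trigonometric monomials vanishes on integrable functions. -/
theorem eq_zero_of_forall_fourier_eq_zero (D : (AddCircle (2 * π) → ℂ) → ℂ) (C : ℝ)
    (hadd : ∀ f g, Integrable f AddCircle.haarAddCircle → Integrable g AddCircle.haarAddCircle →
      D (f + g) = D f + D g)
    (hsmul : ∀ (c : ℂ) f, Integrable f AddCircle.haarAddCircle → D (c • f) = c * D f)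
    (hbound : ∀ f, Integrable f AddCircle.haarAddCircle →
      ‖D f‖ ≤ C * ∫ y, ‖f y‖ ∂AddCircle.haarAddCircle)
    (hfourier : ∀ k : ℤ, D (fourier k) = 0) {f : AddCircle (2 * π) → ℂ}
    (hf : Integrable f AddCircle.haarAddCircle) : D f = 0 := by
  -- `D` acts on functions, not classes; the `L¹` bound makes it blind to null sets.
  have hcongr : ∀ g h : AddCircle (2 * π) → ℂ, Integrable g AddCircle.haarAddCircle →
      g =ᵐ[AddCircle.haarAddCircle] h → D g = D h := fun g h hg hgh => by
    have hh := hg.congr hgh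
    have h1 := hbound (g + (-1 : ℂ) • h) (hg.add (hh.smul _))
    have h2 : ∫ y, ‖(g + (-1 : ℂ) • h) y‖ ∂AddCircle.haarAddCircle = 0 := by
      rw [← integral_zero (AddCircle (2 * π)) ℝ (μ := AddCircle.haarAddCircle)]
      refine integral_congr_ae ?_
      filter_upwards [hgh] with y hy
      simp [hy]
    rw [h2, mul_zero, hadd _ _ hg (hh.smul _), hsmul _ _ hh] at h1
    linear_combination norm_le_zero_iff.1 h1
  have hspan : ∀ p ∈ Submodule.span ℂ (Set.range (fourierLp (T := 2 * π) 1)), D p = 0 := by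
    intro p hp
    induction hp using Submodule.span_induction with
    | mem p hp =>
      obtain ⟨k, rfl⟩ := hp
      rw [hcongr _ _ (L1.integrable_coeFn _) (coeFn_fourierLp 1 k), hfourier]
    | zero =>
      have := hsmul 0 (0 : AddCircle (2 * π) → ℂ) (integrable_zero _ _ _)
      rw [hcongr _ _ (L1.integrable_coeFn _) (Lp.coeFn_zero _ _ _)]
      simpa using this
    | add p q _ _ hp hq =>
      rw [hcongr _ _ (L1.integrable_coeFn _) (Lp.coeFn_add p q),
        hadd _ _ (L1.integrable_coeFn p) (L1.integrable_coeFn q), hp, hq, add_zero]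
    | smul c p _ hp =>
      rw [hcongr _ _ (L1.integrable_coeFn _) (Lp.coeFn_smul c p),
        hsmul _ _ (L1.integrable_coeFn p), hp, mul_zero]
  have hcl : hf.toL1 f ∈ closure
      (Submodule.span ℂ (Set.range (fourierLp (T := 2 * π) 1)) : Set _) := by
    rw [← Submodule.topologicalClosure_coe, span_fourierLp_closure_eq_top ENNReal.one_ne_top]
    trivial
  by_contra hne
  obtain ⟨p, hp, hdist⟩ := Metric.mem_closure_iff.1 hcl (‖D f‖ / (|C| + 1))
    (div_pos (norm_pos_iff.2 hne) (by positivity))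
  have hpi := L1.integrable_coeFn p
  have h1 := hbound (f + (-1 : ℂ) • (p : AddCircle (2 * π) → ℂ)) (hf.add (hpi.smul _))
  have h2 : ∫ y, ‖(f + (-1 : ℂ) • (p : AddCircle (2 * π) → ℂ)) y‖ ∂AddCircle.haarAddCircle =
      dist (hf.toL1 f) p := by
    rw [dist_eq_norm, L1.norm_eq_integral_norm]
    refine integral_congr_ae ?_
    filter_upwards [Lp.coeFn_sub (hf.toL1 f) p, hf.coeFn_toL1] with y hy hy'
    rw [hy, Pi.sub_apply, hy']
    simp [sub_eq_add_neg]
  rw [h2, hadd _ _ hf (hpi.smul _), hsmul _ _ hpi, hspan p hp, mul_zero, add_zero] at h1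
  have h3 : ‖D f‖ ≤ (|C| + 1) * dist (hf.toL1 f) p :=
    h1.trans (mul_le_mul_of_nonneg_right (by linarith [le_abs_self C]) dist_nonneg)
  rw [lt_div_iff₀ (by positivity)] at hdist
  linarith

theorem phiMean_fourier {φ : ℝ → ℂ} (h1 : ∀ y, 1 ≤ |y| → φ y = 0) (n : ℕ) (k : ℤ)
    (x : AddCircle (2 * π)) :
    phiMean φ (fourier k) n x = φ ((k : ℝ) / ((n : ℝ) + 1)) * fourier k x := by
  unfold phiMean
  rw [fourierCoeff_fourier, Finset.sum_eq_single k]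
  · simp
  · intro j _ hj
    simp [Pi.single_eq_of_ne hj]
  -- A frequency outside the sum has `|k| ≥ n + 1`, so `φ` vanishes at `k / (n + 1)`, endpoints
  -- included.
  · intro hk
    rw [Finset.mem_Icc, ← abs_le, not_le] at hk
    have hk' : (n : ℝ) + 1 ≤ |(k : ℝ)| := by exact_mod_cast hk
    rw [h1 _ (by
      have : (0 : ℝ) < (n : ℝ) + 1 := by positivity
      rw [abs_div, abs_of_pos this, le_div_iff₀ this]; linarith)]
    simp

theorem norm_fourierCoeff_le (f : AddCircle (2 * π) → ℂ) (k : ℤ) :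
    ‖fourierCoeff f k‖ ≤ ∫ y, ‖f y‖ ∂AddCircle.haarAddCircle := by
  refine (norm_integral_le_integral_norm _).trans_eq ?_
  simp only [norm_smul, fourier_apply, Circle.norm_coe, one_mul]

theorem norm_phiMean_le (φ : ℝ → ℂ) (f : AddCircle (2 * π) → ℂ) (n : ℕ) (x : AddCircle (2 * π)) :
    ‖phiMean φ f n x‖ ≤ (∑ k ∈ Finset.Icc (-(n : ℤ)) (n : ℤ), ‖φ ((k : ℝ) / ((n : ℝ) + 1))‖) *
      ∫ y, ‖f y‖ ∂AddCircle.haarAddCircle := by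
  rw [Finset.sum_mul]
  refine norm_sum_le_of_le _ fun k _ => ?_
  rw [norm_mul, norm_mul, fourier_apply, Circle.norm_coe, mul_one]
  exact mul_le_mul_of_nonneg_left (norm_fourierCoeff_le f k) (norm_nonneg _)

theorem phiMean_add (φ : ℝ → ℂ) {f g : AddCircle (2 * π) → ℂ}
    (hf : Integrable f AddCircle.haarAddCircle) (hg : Integrable g AddCircle.haarAddCircle)
    (n : ℕ) (x : AddCircle (2 * π)) :
    phiMean φ (f + g) n x = phiMean φ f n x + phiMean φ g n x := by
  simp only [phiMean, fourierCoeff.add hf hg, Pi.add_apply, mul_add, add_mul,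
    Finset.sum_add_distrib]

theorem phiMean_smul (φ : ℝ → ℂ) (c : ℂ) (f : AddCircle (2 * π) → ℂ) (n : ℕ)
    (x : AddCircle (2 * π)) : phiMean φ (c • f) n x = c * phiMean φ f n x := by
  simp only [phiMean, fourierCoeff.const_smul, Finset.mul_sum, smul_eq_mul]
  exact Finset.sum_congr rfl fun k _ => by ring

theorem norm_mul_circlePrimitive_le {K : ℝ → ℂ} {f : AddCircle (2 * π) → ℂ}
    (hf : Integrable f AddCircle.haarAddCircle) (x : AddCircle (2 * π)) {N : ℝ} (hN : 1 ≤ N)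
    (v : ℝ) :
    ‖K v * circlePrimitive f x (2 * π * v / N)‖ ≤
      (‖(v : ℂ) * K v‖ + ‖K v‖) * (2 * π * ∫ y, ‖f y‖ ∂AddCircle.haarAddCircle) := by
  have hN0 : 0 < N := by linarith
  have hT := Real.two_pi_pos
  have hI : 0 ≤ ∫ y, ‖f y‖ ∂AddCircle.haarAddCircle := integral_nonneg fun _ => norm_nonneg _
  rw [norm_mul, norm_mul, Complex.norm_real, Real.norm_eq_abs]
  calc ‖K v‖ * ‖circlePrimitive f x (2 * π * v / N)‖
      ≤ ‖K v‖ * ((2 * π * |v| + 2 * π) * ∫ y, ‖f y‖ ∂AddCircle.haarAddCircle) := by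
        refine mul_le_mul_of_nonneg_left ((norm_circlePrimitive_le hf x _).trans ?_)
          (norm_nonneg _)
        refine mul_le_mul_of_nonneg_right ?_ hI
        rw [abs_div, abs_mul, abs_of_pos hT, abs_of_pos hN0]
        gcongr
        exact div_le_self (by positivity) hN
    _ = _ := by ring

theorem integrable_mul_circlePrimitive {K : ℝ → ℂ} (hK : Integrable K)
    (hK' : Integrable fun v : ℝ => (v : ℂ) * K v) {f : AddCircle (2 * π) → ℂ}
    (hf : Integrable f AddCircle.haarAddCircle) (x : AddCircle (2 * π)) {N : ℝ} (hN : 1 ≤ N) :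
    Integrable fun v => K v * circlePrimitive f x (2 * π * v / N) := by
  refine ((hK'.norm.add hK.norm).mul_const
    (2 * π * ∫ y, ‖f y‖ ∂AddCircle.haarAddCircle)).mono' ?_
    (Eventually.of_forall fun v => norm_mul_circlePrimitive_le hf x hN v)
  exact hK.aestronglyMeasurable.mul
    ((continuous_circlePrimitive hf x).comp (by fun_prop)).aestronglyMeasurable

theorem integral_fourier_mul_exp {P : ℝ → ℂ} (hc : Continuous P) (hP : Integrable P)
    (hF : Integrable (𝓕 P)) (y : ℝ) :
    ∫ v, 𝓕 P v * Complex.exp (2 * π * y * Complex.I * v) = P y := by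
  rw [← congrFun (hc.fourierInv_fourier_eq hP hF) y, Real.fourierInv_eq']
  refine integral_congr_ae (Eventually.of_forall fun v => ?_)
  simp only [RCLike.inner_apply, conj_trivial, smul_eq_mul]
  rw [mul_comm]
  congr 2
  push_cast
  ring

/-- The `φ`-mean as an integral of the indefinite integral of `f` against the Fourier transform
of `y ↦ y φ(y)`. -/
theorem phiMean_eq_integral {φ P : ℝ → ℂ} (hPφ : ∀ y, P y = y * φ y)
    (h1 : ∀ y, 1 ≤ |y| → φ y = 0) (hc : Continuous P) (hP : Integrable P)
    (hF : Integrable (𝓕 P)) (hF' : Integrable fun v : ℝ => (v : ℂ) * 𝓕 P v)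
    (h0 : ∫ v : ℝ, 2 * π * Complex.I * v * 𝓕 P v = φ 0)
    {f : AddCircle (2 * π) → ℂ} (hf : Integrable f AddCircle.haarAddCircle) (n : ℕ)
    (x : AddCircle (2 * π)) :
    phiMean φ f n x = Complex.I * ((n : ℂ) + 1) *
      ∫ v, 𝓕 P v * circlePrimitive f x (2 * π * v / ((n : ℝ) + 1)) := by
  set N : ℝ := (n : ℝ) + 1 with hN
  have hN1 : 1 ≤ N := by simp [hN]
  have hN0 : 0 < N := by linarith
  have hNC : (N : ℂ) ≠ 0 := by exact_mod_cast hN0.ne'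
  have hNc : (n : ℂ) + 1 = N := by simp [hN]
  rw [hNc]
  have hint := fun {f} hf => integrable_mul_circlePrimitive hF hF' (f := f) hf x hN1
  suffices hD : phiMean φ f n x -
      Complex.I * N * ∫ v, 𝓕 P v * circlePrimitive f x (2 * π * v / N) = 0 from sub_eq_zero.1 hD
  -- For fixed `n` both sides are `L¹`-bounded linear functionals of `f`, so monomials suffice.
  refine eq_zero_of_forall_fourier_eq_zero
    (fun f => phiMean φ f n x -
      Complex.I * N * ∫ v, 𝓕 P v * circlePrimitive f x (2 * π * v / N))
    ((∑ k ∈ Finset.Icc (-(n : ℤ)) (n : ℤ), ‖φ ((k : ℝ) / ((n : ℝ) + 1))‖) +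
      N * ((∫ v : ℝ, (‖(v : ℂ) * 𝓕 P v‖ + ‖𝓕 P v‖)) * (2 * π))) ?_ ?_ ?_ ?_ hf
  · intro f g hf hg
    simp only [phiMean_add φ hf hg, circlePrimitive_add hf hg, mul_add]
    rw [integral_add (hint hf) (hint hg)]
    ring
  · intro c f hf
    simp only [phiMean_smul, circlePrimitive_smul, mul_left_comm _ c]
    rw [integral_const_mul]
    ring
  · intro f hf
    refine (norm_sub_le _ _).trans ?_
    rw [add_mul]
    refine add_le_add (norm_phiMean_le φ f n x) ?_
    rw [norm_mul, norm_mul, Complex.norm_I, one_mul, Complex.norm_real, Real.norm_eq_abs,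
      abs_of_pos hN0, mul_assoc N, mul_assoc _ (2 * π), ← integral_mul_const]
    refine mul_le_mul_of_nonneg_left ?_ hN0.le
    exact norm_integral_le_of_norm_le ((hF'.norm.add hF.norm).mul_const _)
      (Eventually.of_forall fun v => norm_mul_circlePrimitive_le hf x hN1 v)
  · intro k
    rw [phiMean_fourier h1, ← hN, sub_eq_zero]
    rcases eq_or_ne k 0 with rfl | hk
    · simp only [circlePrimitive_fourier_zero]
      rw [Int.cast_zero, zero_div, ← h0, ← integral_const_mul]
      simp only [fourier_zero, mul_one]
      refine integral_congr_ae (Eventually.of_forall fun v => ?_)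
      push_cast
      field_simp
    · have hkC : (k : ℂ) ≠ 0 := by exact_mod_cast hk
      have hexp : Integrable fun v : ℝ =>
          𝓕 P v * Complex.exp (2 * π * (k / N : ℝ) * Complex.I * v) := by
        refine hF.mul_bdd (c := 1) (by fun_prop) (Eventually.of_forall fun v => le_of_eq ?_)
        rw [show (2 * π * (k / N : ℝ) * Complex.I * v : ℂ) =
          ((2 * π * (k / N) * v : ℝ) : ℂ) * Complex.I by push_cast; ring,
          Complex.norm_exp_ofReal_mul_I]
      -- Fourier inversion for `P` at `k / N` and at `0`; the factor `k / N` in `P (k / N)` cancels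
      -- the `1 / k` from integrating the monomial, and `P 0 = 0`.
      have key : ∫ v, 𝓕 P v * circlePrimitive (fourier k) x (2 * π * v / N) =
          fourier k x / (k * Complex.I) * (P (k / N) - P 0) := by
        rw [← integral_fourier_mul_exp hc hP hF, ← integral_fourier_mul_exp hc hP hF 0,
          ← integral_sub hexp (by simpa using hF), ← integral_const_mul]
        refine integral_congr_ae (Eventually.of_forall fun v => ?_)
        simp only [circlePrimitive_fourier hk]
        have : (k * Complex.I * (2 * π * v / N : ℝ) : ℂ) =
          2 * π * (k / N : ℝ) * Complex.I * v := by push_cast; field_simp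
        rw [this]
        simp
        ring
      rw [key, hPφ, hPφ]
      push_cast
      field_simp
      simp

/-! ### Passage to the limit at a `d`-point -/

/-- Near `0` convergence bounds the averages; away from `0` the at most linear growth of the
primitive does. -/
theorem HasDValueAt.exists_norm_circlePrimitive_le {f : AddCircle (2 * π) → ℂ}
    (hf : Integrable f AddCircle.haarAddCircle) {x : AddCircle (2 * π)} {d : ℂ}
    (hd : HasDValueAt f x d) : ∃ M, ∀ t : ℝ, ‖(1 / (t : ℂ)) * circlePrimitive f x t‖ ≤ M := by
  have h1 : ∀ᶠ t : ℝ in 𝓝[≠] 0, ‖(1 / (t : ℂ)) * circlePrimitive f x t‖ < ‖d‖ + 1 :=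
    hd.norm.eventually_lt_const (lt_add_one _)
  rw [eventually_nhdsWithin_iff, Metric.eventually_nhds_iff] at h1
  obtain ⟨δ, hδ, h1⟩ := h1
  set J := ∫ y, ‖f y‖ ∂AddCircle.haarAddCircle
  have hJ : 0 ≤ J := integral_nonneg fun _ => norm_nonneg _
  have hT := Real.two_pi_pos
  refine ⟨max (‖d‖ + 1) ((1 + 2 * π / δ) * J), fun t => ?_⟩
  rcases eq_or_ne t 0 with rfl | ht
  · simp only [Complex.ofReal_zero, div_zero, zero_mul, norm_zero]
    exact le_max_of_le_left (by positivity)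
  rcases lt_or_ge |t| δ with h | h
  · exact le_max_of_le_left (h1 (by simpa using h) ht).le
  · refine le_max_of_le_right ?_
    have ht0 : 0 < |t| := abs_pos.2 ht
    rw [norm_mul, norm_div, norm_one, Complex.norm_real, Real.norm_eq_abs]
    calc 1 / |t| * ‖circlePrimitive f x t‖ ≤ 1 / |t| * ((|t| + 2 * π) * J) := by
          gcongr
          exact norm_circlePrimitive_le hf x t
      _ = (1 + 2 * π / |t|) * J := by field_simp
      _ ≤ (1 + 2 * π / δ) * J := by gcongr

theorem tendsto_integral_mul_circlePrimitive {K : ℝ → ℂ}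
    (hKc : Continuous K)
    (hK' : Integrable fun v : ℝ => 2 * π * Complex.I * v * K v)
    (h0 : ∫ v : ℝ, 2 * π * Complex.I * v * K v = 1)
    {f : AddCircle (2 * π) → ℂ} (hf : Integrable f AddCircle.haarAddCircle)
    {x : AddCircle (2 * π)} {d : ℂ} (hd : HasDValueAt f x d) :
    Tendsto (fun n : ℕ => Complex.I * ((n : ℂ) + 1) *
      ∫ v, K v * circlePrimitive f x (2 * π * v / ((n : ℝ) + 1))) atTop (𝓝 d) := by
  obtain ⟨M, hM⟩ := hd.exists_norm_circlePrimitive_le hf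
  have hrw : ∀ (n : ℕ) (v : ℝ), Complex.I * ((n : ℂ) + 1) *
      (K v * circlePrimitive f x (2 * π * v / ((n : ℝ) + 1))) =
      2 * π * Complex.I * v * K v * ((1 / ((2 * π * v / ((n : ℝ) + 1) : ℝ) : ℂ)) *
        circlePrimitive f x (2 * π * v / ((n : ℝ) + 1))) := fun n v => by
    rcases eq_or_ne v 0 with rfl | hv
    · simp [circlePrimitive]
    · have h1 : (v : ℂ) ≠ 0 := by exact_mod_cast hv
      have h2 : (π : ℂ) ≠ 0 := by exact_mod_cast Real.pi_ne_zero
      have h3 : (n : ℂ) + 1 ≠ 0 := by exact_mod_cast n.succ_ne_zero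
      push_cast
      field_simp
  have hlim : ∫ v : ℝ, 2 * π * Complex.I * v * K v * d = d := by
    rw [integral_mul_const, h0, one_mul]
  rw [← hlim]
  simp only [← integral_const_mul]
  refine tendsto_integral_of_dominated_convergence
    (fun v => ‖2 * π * Complex.I * v * K v‖ * M) ?_ (hK'.norm.mul_const M) ?_ ?_
  · intro n
    have := continuous_circlePrimitive hf x
    exact Continuous.aestronglyMeasurable (by fun_prop)
  · intro n
    refine Eventually.of_forall fun v => ?_
    rw [hrw, norm_mul]
    exact mul_le_mul_of_nonneg_left (hM _) (norm_nonneg _)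
  · have hne : ∀ᵐ v : ℝ, v ≠ 0 := Measure.ae_ne volume 0
    filter_upwards [hne] with v hv
    simp only [hrw]
    refine Tendsto.const_mul _ (hd.comp (tendsto_nhdsWithin_iff.2 ⟨?_, ?_⟩))
    · exact tendsto_const_nhds.div_atTop
        (tendsto_atTop_add_const_right _ _ tendsto_natCast_atTop_atTop)
    · refine Eventually.of_forall fun n => ?_
      have : (0 : ℝ) < (n : ℝ) + 1 := by positivity
      exact div_ne_zero (mul_ne_zero Real.two_pi_pos.ne' hv) this.ne'

/-! ### Regularity of `y * φ y` and the conclusion -/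

theorem hasDerivAt_ofReal_mul_of_continuousAt {φ : ℝ → ℂ} (hc : ContinuousAt φ 0) :
    HasDerivAt (fun x : ℝ => (x : ℂ) * φ x) (φ 0) 0 := by
  rw [hasDerivAt_iff_tendsto_slope_zero]
  refine (hc.tendsto.mono_left nhdsWithin_le_nhds).congr' ?_
  filter_upwards [self_mem_nhdsWithin] with t ht
  have : (t : ℂ) ≠ 0 := by exact_mod_cast ht
  simp [this]

theorem hasDerivAt_ofReal_mul {φ : ℝ → ℂ} (hc : Continuous φ)
    (hd : DifferentiableOn ℝ φ {0}ᶜ) (x : ℝ) :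
    HasDerivAt (fun x : ℝ => (x : ℂ) * φ x) (φ x + x * deriv φ x) x := by
  rcases eq_or_ne x 0 with rfl | hx
  · simpa using hasDerivAt_ofReal_mul_of_continuousAt hc.continuousAt
  · have h1 := (hd.differentiableAt (isOpen_compl_singleton.mem_nhds hx)).hasDerivAt
    have h2 := (hasDerivAt_id x).ofReal_comp.mul h1
    simp only [id, Complex.ofReal_one, one_mul] at h2
    exact h2

/-- Uniform continuity yields some limit `c`. Then `x * φ x` has derivative `φ 0 + c` at `0`, as the
limit of nearby derivatives, while its difference quotient gives `φ 0`; so `c = 0`. -/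
theorem tendsto_ofReal_mul_deriv {φ : ℝ → ℂ} (hc : Continuous φ)
    (hd : DifferentiableOn ℝ φ {0}ᶜ)
    (hu : UniformContinuousOn (fun x : ℝ => (x : ℂ) * deriv φ x) {0}ᶜ) :
    Tendsto (fun x : ℝ => (x : ℂ) * deriv φ x) (𝓝[≠] 0) (𝓝 0) := by
  have hcau : Cauchy (map (fun x : ℝ => (x : ℂ) * deriv φ x) (𝓝[≠] 0)) :=
    ((cauchy_nhds (a := (0 : ℝ))).mono nhdsWithin_le_nhds).map_of_le hu inf_le_right
  obtain ⟨c, hlim⟩ := CompleteSpace.complete hcau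
  have hne : ∀ y : ℝ, y ≠ 0 →
      Function.update (fun x : ℝ => (x : ℂ) * deriv φ x) 0 c y = y * deriv φ y :=
    fun y hy => Function.update_of_ne hy _ _
  have h1 := hasDerivAt_of_hasDerivAt_of_ne (x := 0) (f := fun x : ℝ => (x : ℂ) * φ x)
    (g := fun x => φ x + Function.update (fun x : ℝ => (x : ℂ) * deriv φ x) 0 c x)
    (fun y hy => by rw [hne y hy]; exact hasDerivAt_ofReal_mul hc hd y)
    (by fun_prop) (hc.continuousAt.add (continuousAt_update_same.2 hlim))
  have h2 := h1.unique (hasDerivAt_ofReal_mul_of_continuousAt hc.continuousAt)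
  simp only [Function.update_self, add_eq_left] at h2
  rwa [h2] at hlim

theorem continuous_ofReal_mul_deriv {φ : ℝ → ℂ} (hc : Continuous φ)
    (hd : DifferentiableOn ℝ φ {0}ᶜ)
    (hu : UniformContinuousOn (fun x : ℝ => (x : ℂ) * deriv φ x) {0}ᶜ) :
    Continuous fun x : ℝ => (x : ℂ) * deriv φ x := by
  rw [continuous_iff_continuousAt]
  intro x
  rcases eq_or_ne x 0 with rfl | hx
  -- The value at `0` is `0` whatever `deriv φ 0` is, because of the factor `x`.
  · rw [← continuousWithinAt_compl_self, ContinuousWithinAt]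
    simpa using tendsto_ofReal_mul_deriv hc hd hu
  · exact hu.continuousOn.continuousAt (isOpen_compl_singleton.mem_nhds hx)

theorem integrable_of_integrable_ofReal_mul {K : ℝ → ℂ} (hc : Continuous K)
    (h : Integrable fun v : ℝ => (v : ℂ) * K v) : Integrable K := by
  have h1 : Integrable ((Set.Icc (-1 : ℝ) 1).indicator K) :=
    (integrable_indicator_iff measurableSet_Icc).2 hc.integrableOn_Icc
  refine (h1.norm.add h.norm).mono' hc.aestronglyMeasurable (Eventually.of_forall fun v => ?_)
  simp only [Pi.add_apply, norm_mul, Complex.norm_real, Real.norm_eq_abs]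
  by_cases hv : v ∈ Set.Icc (-1 : ℝ) 1
  · rw [Set.indicator_of_mem hv]
    exact le_add_of_nonneg_right (by positivity)
  · rw [Set.indicator_of_notMem hv, norm_zero, zero_add]
    rw [Set.mem_Icc, ← abs_le, not_le] at hv
    exact le_mul_of_one_le_left (norm_nonneg _) hv.le

/-- The support is open, hence inside the interior of `[-1, 1]`. -/
theorem eq_zero_of_one_le_abs {φ : ℝ → ℂ} (hc : Continuous φ)
    (hsupp : tsupport φ ⊆ Set.Icc (-1) 1) (y : ℝ) (hy : 1 ≤ |y|) : φ y = 0 := by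
  by_contra hne
  have h1 : Function.support φ ⊆ Set.Ioo (-1) 1 := by
    rw [← interior_Icc]
    exact interior_maximal ((subset_tsupport φ).trans hsupp)
      (hc.isOpen_support)
  exact absurd (abs_lt.2 (h1 hne)) (not_lt.2 hy)

theorem corollary5 (φ : ℝ → ℂ)
    (hcont : Continuous φ) (hC1 : ContDiffOn ℝ 1 φ {0}ᶜ)
    (hφ0 : φ 0 = 1) (hsupp : tsupport φ ⊆ Set.Icc (-1) 1)
    (ε : ℝ≥0) (hε : 0 < ε)
    (hφ : BVLipOn ε φ Set.univ)
    (hφ' : BVLipOn ε (fun x : ℝ => (x : ℂ) * deriv φ x) {0}ᶜ)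
    (f : AddCircle (2 * π) → ℂ) (hf : Integrable f AddCircle.haarAddCircle)
    (x : AddCircle (2 * π)) (d : ℂ) (hd : HasDValueAt f x d) :
    Tendsto (fun n : ℕ => phiMean φ f n x) atTop (𝓝 d) := by
  have hdiff : DifferentiableOn ℝ φ {0}ᶜ := hC1.differentiableOn one_ne_zero
  have h1 := eq_zero_of_one_le_abs hcont hsupp
  set ψ : ℝ → ℂ := fun x => (x : ℂ) * deriv φ x with hψ
  have hψc : Continuous ψ := by
    obtain ⟨-, C, hC⟩ := hφ'
    exact continuous_ofReal_mul_deriv hcont hdiff (hC.uniformContinuousOn hε)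
  have hψ1 : ∀ y, 1 < |y| → ψ y = 0 := fun y hy => by
    have : φ =ᶠ[𝓝 y] fun _ => 0 := by
      filter_upwards [continuous_abs.continuousAt.eventually_const_lt hy] with z hz using h1 z hz.le
    simp [hψ, this.deriv_eq]
  have hcs : ∀ g : ℝ → ℂ, (∀ y, 1 < |y| → g y = 0) → HasCompactSupport g := fun g hg =>
    HasCompactSupport.of_support_subset_isCompact (isCompact_Icc (a := -1) (b := 1))
      fun y hy => abs_le.1 <| not_lt.1 fun h => hy (hg y h)
  have hφi : Integrable φ := hcont.integrable_of_hasCompactSupport (hcs φ fun y hy => h1 y hy.le)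
  have hψi : Integrable ψ := hψc.integrable_of_hasCompactSupport (hcs ψ hψ1)
  set P : ℝ → ℂ := fun x => (x : ℂ) * φ x with hP
  have hPc : Continuous P := by fun_prop
  have hPi : Integrable P := hPc.integrable_of_hasCompactSupport
    (hcs P fun y hy => by simp [hP, h1 y hy.le])
  have hPd : ∀ y, HasDerivAt P (φ y + ψ y) y := hasDerivAt_ofReal_mul hcont hdiff
  have hderiv : deriv P = fun y => φ y + ψ y := funext fun y => (hPd y).deriv
  have hgi : Integrable fun y => φ y + ψ y := hφi.add hψi
  have hFadd : (𝓕 fun y => φ y + ψ y) = fun v => 𝓕 φ v + 𝓕 ψ v := funext fun v => by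
    simp only [Real.fourier_eq, smul_add]
    exact integral_add ((Real.fourierIntegral_convergent_iff v).2 hφi)
      ((Real.fourierIntegral_convergent_iff v).2 hψi)
  have hFg : Integrable (𝓕 fun y => φ y + ψ y) := by
    rw [hFadd]
    refine (hφ.integrable_fourier hε (by simp) hcont fun y hy => h1 y hy.le).add
      (hφ'.integrable_fourier hε ?_ hψc hψ1)
    exact Measure.ae_ne volume 0
  have hFP : (𝓕 fun y => φ y + ψ y) = fun v : ℝ => 2 * π * Complex.I * v * 𝓕 P v := by
    rw [← hderiv]
    exact Real.fourier_deriv hPi (fun y => (hPd y).differentiableAt) (by rwa [hderiv])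
  have h0 : ∫ v : ℝ, 2 * π * Complex.I * v * 𝓕 P v = 1 := by
    have := integral_fourier_mul_exp (P := fun y => φ y + ψ y) (by fun_prop) hgi hFg 0
    rw [hFP] at this
    simpa [hψ, hφ0] using this
  rw [hFP] at hFg
  have hFv : Integrable fun v : ℝ => (v : ℂ) * 𝓕 P v := by
    refine (hFg.const_mul (2 * π * Complex.I)⁻¹).congr (Eventually.of_forall fun v => ?_)
    have : (π : ℂ) ≠ 0 := by exact_mod_cast Real.pi_ne_zero
    simp only
    field_simp
  have hFc := Real.continuous_fourier_of_integrable hPi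
  have hFi := integrable_of_integrable_ofReal_mul hFc hFv
  simp only [phiMean_eq_integral (fun _ => rfl) h1 hPc hPi hFi hFv (h0.trans hφ0.symm) hf]
  exact tendsto_integral_mul_circlePrimitive hFc hFg h0 hf hd
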